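/- **Game.** There are $K$ follower types $\theta_1,\dots,\theta_K$ with prior probabilities $\mu(\theta)$, $M\ge 1$ leader actions, $N\ge1$ follower actions, a leader payoff $L:[M]\times[N]\to\mathbb R$ and follower payoffs $F^{\theta}:[M]\times[N]\to\mathbb R$. A belief is a point $b$ of the probability simplex $\Delta_M$. Let $BR^\theta(b)$ be an action $j\in\arg\max_j\sum_i b(i)F^\theta(i,j)$, ties being broken in favor of the leader, and put $F^\theta(b)=\sum_i b(i)F^\theta(i,BR^\theta(b))$, $V^\theta(b)=\sum_i b(i)L(i,BR^\theta(b))$. For $\boldsymbol j\in[N]^K$ let $\Xi_{\boldsymbol j}\subset\Delta_M$ be the polytope of beliefs at which, for every $k$, the action $j^k$ attains $\max_{j}\sum_i b(i)F^{\theta_k}(i,j)$; let $\hat\Xi$ be the finite set of all vertices of all $\Xi_{\boldsymbol j}$. Let $\widehat\Pi\subset\mathbb R^{K|\hat\Xi|}$ be the polytope of tuples $\boldsymbol\pi=(\pi^{\theta})_\theta$ of probability distributions on $\hat\Xi$ all having the same mean $\sum_b\pi^\theta(b)\,b$. A follower of type $\theta$ who reports $\hat\theta$ obtains $U(\boldsymbol\pi,(\hat\theta;\theta))=\sum_b\pi^{\hat\theta}(b)F^\theta(b)$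 and the leader obtains $V(\boldsymbol\pi,(\hat\theta;\theta))=\sum_b\pi^{\hat\theta}(b)V^\theta(b)$. The report $\psi_\theta(\boldsymbol\pi)\in\arg\max_{\hat\theta}U(\boldsymbol\pi,(\hat\theta;\theta))$ is selected by an arbitrary fixed rule depending only on $\theta$ and on the set of maximizers. Let $V^\mu(\boldsymbol\pi)=\sum_\theta\mu(\theta)V(\boldsymbol\pi,(\psi_\theta(\boldsymbol\pi);\theta))$. For $\epsilon>0$, a point $\boldsymbol\pi^\epsilon\in\widehat\Pi$ is an $\epsilon$-equilibrium if $\sup_{\widehat\Pi}V^\mu$ is finite and $\sup_{\widehat\Pi}V^\mu-V^\mu(\boldsymbol\pi^\epsilon)<\epsilon$. **Candidate set.** For every map $\gamma:\Theta\to\Theta$ let $\mathcal P^\gamma=\{\boldsymbol\pi\in\widehat\Pi:\psi_\theta(\boldsymbol\pi)=\gamma(\theta)\ \forall\theta\}$. Given $\delta>0$, a set $\Pi^\delta$ is formed as follows: for every $\gamma$ and every extreme point $\boldsymbol v$ of the closure $\overline{\mathcal P^\gamma}$, include $\boldsymbol v$ if $\boldsymbol v\in\mathcal P^\gamma$, and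 otherwise include one arbitrarily chosen $\boldsymbol\pi'\in\mathcal P^\gamma$ with $\|\boldsymbol v-\boldsymbol\pi'\|_2\le\delta$. **Theorem.** 1. Let $\epsilon>0$ and let $\delta>0$ satisfy $\delta\,\|(V^\theta(b))_{b\in\hat\Xi}\|_2\le\epsilon$ for every $\theta$ (for instance $\delta=\min_\theta\epsilon/\|V^\theta\|_2$). Then a set $\Pi^\delta$ as above exists, and every such set, whatever the choices made, is finite and contains an $\epsilon$-equilibrium; moreover every maximizer of $V^\mu$ over $\Pi^\delta$ is an $\epsilon$-equilibrium, so that an $\epsilon$-equilibrium is found by evaluating $V^\mu$ at the $|\Pi^\delta|$ candidates. 2. The number of candidates is $O\big(\binom{K^{K+2}}{K|\hat\Xi|}K^K\big)$ in the following sense: there are absolute constants $C,c>0$ such that for every $\delta>0$ and every $\Pi^\delta$ as above, $$|\Pi^\delta|\le C\binom{K^{K+2}}{K|\hat\Xi|}K^K\qquad\text{whenever } |\hat\Xi|\le c\,K^{K+1},$$ and for fixed $M,N$ this last condition holds for all games with $K$ types as soon as $K$ is sufficiently large (depending only on $M,N$). -/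

import Mathlib

open scoped BigOperators

/-- A set cut out by finitely many affine inequalities has finitely many extreme points. -/
theorem finite_extremePoints_of_inequalities {E ι : Type*} [AddCommGroup E] [Module ℝ E] [Finite ι]
    (f : ι → E →ₗ[ℝ] ℝ) (c : ι → ℝ) :
    (Set.extremePoints ℝ {x : E | ∀ i, f i x ≤ c i}).Finite := by
  classical
  have := Fintype.ofFinite ι
  refine Set.Finite.of_finite_image (f := fun x => {i : ι | f i x = c i}) (Set.toFinite _) ?_
  intro x hx y hy hxy
  by_contra hne
  have hact : ∀ i, f i x = c i ↔ f i y = c i := fun i => by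
    have := Set.ext_iff.1 hxy i
    simpa using this
  have hex : ∀ i, ∃ t : ℝ, 0 < t ∧ ∀ s : ℝ, |s| ≤ t → f i x + s * (f i x - f i y) ≤ c i := by
    intro i
    by_cases h : f i x = c i
    · refine ⟨1, one_pos, fun s _ => ?_⟩
      rw [h, (hact i).1 h]; simp
    · have hlt : 0 < c i - f i x := sub_pos.2 (lt_of_le_of_ne (hx.1 i) h)
      have hd : 0 < |f i x - f i y| + 1 := by positivity
      refine ⟨(c i - f i x) / (|f i x - f i y| + 1), by positivity, fun s hs => ?_⟩
      have h1 : s * (f i x - f i y) ≤ |s| * |f i x - f i y| := by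
        rw [← abs_mul]; exact le_abs_self _
      have h2 : |s| * (|f i x - f i y| + 1) ≤ c i - f i x := (le_div_iff₀ hd).1 hs
      nlinarith [abs_nonneg s]
  choose t ht0 ht using hex
  obtain ⟨r, hr0, hr⟩ : ∃ r : ℝ, 0 < r ∧ ∀ i, r ≤ t i := by
    rcases isEmpty_or_nonempty ι with h | h
    · exact ⟨1, one_pos, fun i => (h.false i).elim⟩
    · obtain ⟨i₀, hi₀⟩ := Finite.exists_min t
      exact ⟨t i₀, ht0 i₀, hi₀⟩
  have hmem : ∀ s : ℝ, |s| ≤ r → x + s • (x - y) ∈ {x : E | ∀ i, f i x ≤ c i} := by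
    intro s hs i
    have := ht i s (hs.trans (hr i))
    simpa [map_add, map_smul, map_sub] using this
  have h1 := hmem r (abs_of_pos hr0).le
  have h2 := hmem (-r) (by rw [abs_neg, abs_of_pos hr0])
  have hseg : x ∈ openSegment ℝ (x + r • (x - y)) (x + (-r) • (x - y)) := by
    refine ⟨1 / 2, 1 / 2, by norm_num, by norm_num, by norm_num, ?_⟩
    module
  have h3 : x + r • (x - y) = x := hx.2 h1 h2 hseg
  have h4 : r • (x - y) = 0 := by simpa using h3
  rcases smul_eq_zero.1 h4 with h | h
  · exact hr0.ne' h
  · exact hne (sub_eq_zero.1 h)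

/-- A signaling Bayesian Stackelberg game with `K` follower types, `M` leader actions and `N`
follower actions.  `tie` is the follower's rule for choosing a report when several reports are
optimal: the report of type `k` depends only on `k` and on the set of optimal reports. -/
structure SigBSG (K M N : ℕ) where
  prior : Fin K → ℝ
  prior_mem : prior ∈ stdSimplex ℝ (Fin K)
  L : Fin M → Fin N → ℝ
  F : Fin K → Fin M → Fin N → ℝ
  tie : Fin K → Finset (Fin K) → Fin K
  tie_mem : ∀ (k : Fin K) (S : Finset (Fin K)), S.Nonempty → tie k S ∈ S

namespace SigBSG

variable {K M N : ℕ} (G : SigBSG K M N)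

/-- Expected payoff of a type-`k` follower who plays `j` under the belief `b`. -/
def followerPayoff (k : Fin K) (b : Fin M → ℝ) (j : Fin N) : ℝ := ∑ i, b i * G.F k i j

/-- Expected payoff of the leader if the follower plays `j` under the belief `b`. -/
def leaderPayoff (b : Fin M → ℝ) (j : Fin N) : ℝ := ∑ i, b i * G.L i j

/-- The follower's actions that maximize his expected payoff under the belief `b`. -/
def brSet (k : Fin K) (b : Fin M → ℝ) : Set (Fin N) :=
  {j | ∀ j', G.followerPayoff k b j' ≤ G.followerPayoff k b j}

theorem exists_favorable_response [NeZero N] (k : Fin K) (b : Fin M → ℝ) :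
    ∃ j ∈ G.brSet k b, ∀ j' ∈ G.brSet k b, G.leaderPayoff b j' ≤ G.leaderPayoff b j := by
  obtain ⟨j₀, hj₀⟩ := Finite.exists_max (G.followerPayoff k b)
  exact Set.exists_max_image (G.brSet k b) (G.leaderPayoff b) (Set.toFinite _) ⟨j₀, hj₀⟩

/-- The best response of type `k` under the belief `b`, ties broken in favor of the leader. -/
noncomputable def bestResponse [NeZero N] (k : Fin K) (b : Fin M → ℝ) : Fin N :=
  (G.exists_favorable_response k b).choose

/-- `F^θ(b)`. -/
noncomputable def followerValue [NeZero N] (k : Fin K) (b : Fin M → ℝ) : ℝ :=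
  G.followerPayoff k b (G.bestResponse k b)

/-- `V^θ(b)`. -/
noncomputable def leaderValue [NeZero N] (k : Fin K) (b : Fin M → ℝ) : ℝ :=
  G.leaderPayoff b (G.bestResponse k b)

/-- The polytope of beliefs for which `j k` is a best response of type `k`, for every `k`. -/
def cell (j : Fin K → Fin N) : Set (Fin M → ℝ) :=
  {b | b ∈ stdSimplex ℝ (Fin M) ∧ ∀ k, j k ∈ G.brSet k b}

/-- The finite set of all vertices of the polytopes `cell j`. -/
def vertexBeliefs : Set (Fin M → ℝ) := ⋃ j : Fin K → Fin N, Set.extremePoints ℝ (G.cell j)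

theorem finite_vertexBeliefs : G.vertexBeliefs.Finite := by
  refine Set.finite_iUnion fun j => ?_
  let pay : Fin K → Fin N → ((Fin M → ℝ) →ₗ[ℝ] ℝ) := fun k a =>
    ∑ i, G.F k i a • (LinearMap.proj i : (Fin M → ℝ) →ₗ[ℝ] ℝ)
  have hpay : ∀ k a b, pay k a b = G.followerPayoff k b a := fun k a b => by
    simp [pay, followerPayoff, mul_comm]
  let tot : (Fin M → ℝ) →ₗ[ℝ] ℝ := ∑ i, (LinearMap.proj i : (Fin M → ℝ) →ₗ[ℝ] ℝ)
  let f : (Fin M ⊕ Bool) ⊕ (Fin K × Fin N) → ((Fin M → ℝ) →ₗ[ℝ] ℝ) :=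
    Sum.elim (Sum.elim (fun i => -(LinearMap.proj i : (Fin M → ℝ) →ₗ[ℝ] ℝ))
      (fun s => if s then tot else -tot)) (fun p => pay p.1 p.2 - pay p.1 (j p.1))
  let c : (Fin M ⊕ Bool) ⊕ (Fin K × Fin N) → ℝ :=
    Sum.elim (Sum.elim (fun _ => 0) (fun s => if s then 1 else -1)) (fun _ => 0)
  have h : G.cell j = {b | ∀ q, f q b ≤ c q} := by
    ext b
    constructor
    · rintro ⟨⟨h0, h1⟩, h2⟩
      rintro ((i | s) | ⟨k, a⟩)
      · simpa [f, c] using h0 i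
      · cases s <;> simp [f, c, tot, h1]
      · simpa [f, c, hpay] using h2 k a
    · intro hb
      refine ⟨⟨fun i => ?_, ?_⟩, fun k a => ?_⟩
      · simpa [f, c] using hb (Sum.inl (Sum.inl i))
      · have h1 := hb (Sum.inl (Sum.inr true))
        have h2 := hb (Sum.inl (Sum.inr false))
        simp [f, c, tot] at h1 h2
        linarith
      · simpa [f, c, hpay] using hb (Sum.inr (k, a))
  rw [h]
  exact finite_extremePoints_of_inequalities f c

noncomputable instance : Fintype G.vertexBeliefs := G.finite_vertexBeliefs.fintype

/-- The space `ℝ^{K|Ξ̂|}` with the `ℓ₂` norm; `π (k, b)` is the mass `π^{θ_k}(b)`. -/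
abbrev Signaling : Type := EuclideanSpace ℝ (Fin K × G.vertexBeliefs)

/-- Tuples of probability distributions on `vertexBeliefs` that all have the same mean belief. -/
def consistent : Set G.Signaling :=
  {π | (∀ k, (∀ b, 0 ≤ π (k, b)) ∧ ∑ b, π (k, b) = 1) ∧
    ∀ k l : Fin K, ∀ i : Fin M,
      ∑ b, π (k, b) * (b : Fin M → ℝ) i = ∑ b, π (l, b) * (b : Fin M → ℝ) i}

/-- `U(π, (θ_l; θ_k))`: the expected utility of type `k` when he reports `l`. -/
noncomputable def U [NeZero N] (π : G.Signaling) (l k : Fin K) : ℝ :=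
  ∑ b, π (l, b) * G.followerValue k b

/-- `V(π, (θ_l; θ_k))`: the leader's expected utility when type `k` reports `l`. -/
noncomputable def V [NeZero N] (π : G.Signaling) (l k : Fin K) : ℝ :=
  ∑ b, π (l, b) * G.leaderValue k b

open Classical in
/-- The set of optimal reports of type `k`. -/
noncomputable def optimalReports [NeZero N] (k : Fin K) (π : G.Signaling) : Finset (Fin K) :=
  Finset.univ.filter fun l => ∀ l', G.U π l' k ≤ G.U π l k

/-- `ψ_{θ_k}(π)`: the report of type `k`. -/
noncomputable def report [NeZero N] (k : Fin K) (π : G.Signaling) : Fin K :=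
  G.tie k (G.optimalReports k π)

/-- `V^μ(π)`: the leader's expected utility. -/
noncomputable def leaderUtility [NeZero N] (π : G.Signaling) : ℝ :=
  ∑ k, G.prior k * G.V π (G.report k π) k

/-- `π` is an `ε`-equilibrium: its utility is within `ε` of the (finite) supremum. -/
def IsEpsEquilibrium [NeZero N] (ε : ℝ) (π : G.Signaling) : Prop :=
  π ∈ G.consistent ∧ ∃ s : ℝ, IsLUB (G.leaderUtility '' G.consistent) s ∧
    s - G.leaderUtility π < ε

/-- `P^γ`: the signalings under which every type `k` reports `γ k`. -/
def region [NeZero N] (γ : Fin K → Fin K) : Set G.Signaling :=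
  {π | π ∈ G.consistent ∧ ∀ k, G.report k π = γ k}

/-- The vector `(V^{θ_k}(b))_b`, with the `ℓ₂` norm. -/
noncomputable def valueVector [NeZero N] (k : Fin K) : EuclideanSpace ℝ G.vertexBeliefs :=
  WithLp.toLp 2 fun b => G.leaderValue k b

/-- A choice, for every `γ` and every vertex `v` of the closure of `P^γ`, of a point of `P^γ`:
the vertex `v` itself if it lies in `P^γ`, otherwise any point of `P^γ` within distance `δ`. -/
def IsVertexSelection [NeZero N] (δ : ℝ)
    (sel : (Fin K → Fin K) → G.Signaling → G.Signaling) : Prop :=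
  ∀ γ : Fin K → Fin K, ∀ v ∈ Set.extremePoints ℝ (closure (G.region γ)),
    (v ∈ G.region γ → sel γ v = v) ∧
    (v ∉ G.region γ → sel γ v ∈ G.region γ ∧ ‖v - sel γ v‖ ≤ δ)

/-- `Π^δ`: the points produced by a selection `sel`. -/
def candidates [NeZero N] (sel : (Fin K → Fin K) → G.Signaling → G.Signaling) :
    Set G.Signaling :=
  {π | ∃ γ : Fin K → Fin K, ∃ v ∈ Set.extremePoints ℝ (closure (G.region γ)), π = sel γ v}

end SigBSG

/-! On each region `P^γ` the leader's utility is a linear functional, `regionUtility γ`. The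
closures of the finitely many regions are compact, so the supremum is the value of some
`regionUtility γ` at an extreme point `v` of `closure (G.region γ)`. Replacing `v` by a point within
`δ` costs at most `ε`, by Cauchy–Schwarz on each block.

An `ε`-equilibrium asks for strict inequality, so the equality case needs care. A loss of `ε`
forces, for every type of positive probability, the value vector to be `ε / δ ^ 2` times the block
of the displacement at `γ k`, and that block to have norm `δ`. Only one block can carry the whole
norm, so these types share one value vector. Sending one best belief under all reports is then
optimal (`exists_constSignaling_optimal`); that signaling is an extreme point of the whole polytope
and hence belongs to every candidate set.

For the count, a region is a finite union of strata on which the sets of optimal reports are fixed.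
The closure of a nonempty stratum is a face of the polytope on which every report `γ k` is optimal,
so each extreme point of the closed region is a vertex of that polytope. A vertex is determined by
as many tight constraints as the dimension, which gives a binomial bound for each of the `K ^ K`
maps `γ`. -/

/-! ### Vertices of polyhedra and their tight constraints. -/

/-- At an extreme point of a polyhedron the tight functionals separate points. -/
theorem eq_zero_of_tight_of_mem_extremePoints {E ι : Type*} [AddCommGroup E] [Module ℝ E]
    [Finite ι] (f : ι → E →ₗ[ℝ] ℝ) (c : ι → ℝ) (T : Set ι) {x : E}
    (hx : x ∈ Set.extremePoints ℝ {x : E | (∀ i, f i x ≤ c i) ∧ ∀ i ∈ T, f i x = c i})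
    {y : E} (hy : ∀ i, f i x = c i → f i y = 0) : y = 0 := by
  classical
  -- Moving along `y` leaves tight constraints unchanged, and slack ones survive a small move; the
  -- `+ 1` below avoids a zero denominator.
  have hex : ∀ i, ∃ t : ℝ, 0 < t ∧ ∀ s : ℝ, |s| ≤ t → f i x + s * f i y ≤ c i := by
    intro i
    by_cases h : f i x = c i
    · exact ⟨1, one_pos, fun s _ => by rw [hy i h, h]; simp⟩
    · have hlt : 0 < c i - f i x := sub_pos.2 (lt_of_le_of_ne (hx.1.1 i) h)
      have hd : 0 < |f i y| + 1 := by positivity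
      refine ⟨(c i - f i x) / (|f i y| + 1), by positivity, fun s hs => ?_⟩
      have h1 : s * f i y ≤ |s| * |f i y| := by
        rw [← abs_mul]; exact le_abs_self _
      have h2 : |s| * (|f i y| + 1) ≤ c i - f i x := (le_div_iff₀ hd).1 hs
      nlinarith [abs_nonneg s]
  choose t ht0 ht using hex
  obtain ⟨r, hr0, hr⟩ : ∃ r : ℝ, 0 < r ∧ ∀ i, r ≤ t i := by
    rcases isEmpty_or_nonempty ι with h | h
    · exact ⟨1, one_pos, fun i => (h.false i).elim⟩
    · obtain ⟨i₀, hi₀⟩ := Finite.exists_min t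
      exact ⟨t i₀, ht0 i₀, hi₀⟩
  have hmem : ∀ s : ℝ, |s| ≤ r →
      x + s • y ∈ {x : E | (∀ i, f i x ≤ c i) ∧ ∀ i ∈ T, f i x = c i} := by
    intro s hs
    refine ⟨fun i => by simpa using ht i s (hs.trans (hr i)), fun i hi => ?_⟩
    simp [hy i (hx.1.2 i hi), hx.1.2 i hi]
  have h1 := hmem r (abs_of_pos hr0).le
  have h2 := hmem (-r) (by rw [abs_neg, abs_of_pos hr0])
  have hseg : x ∈ openSegment ℝ (x + r • y) (x + (-r) • y) :=
    ⟨1 / 2, 1 / 2, by norm_num, by norm_num, by norm_num, by module⟩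
  have h4 : r • y = 0 := by simpa using hx.2 h1 h2 hseg
  exact (smul_eq_zero.1 h4).resolve_left hr0.ne'

/-- A family of functionals with trivial common kernel contains a subfamily, indexed by as many
indices as the dimension, with trivial common kernel. -/
theorem exists_finset_card_eq_finrank_of_separating {E ι : Type*} [AddCommGroup E] [Module ℝ E]
    [FiniteDimensional ℝ E] [Finite ι] (f : ι → E →ₗ[ℝ] ℝ) (T : Set ι)
    (h : ∀ y, (∀ i ∈ T, f i y = 0) → y = 0) :
    ∃ s : Finset ι, s.card = Module.finrank ℝ E ∧ ↑s ⊆ T ∧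
      ∀ y, (∀ i ∈ s, f i y = 0) → y = 0 := by
  classical
  obtain ⟨κ, a, ha, hspan, hli⟩ := exists_linearIndependent' ℝ (fun i : T => f i)
  have : Finite κ := Finite.of_injective a ha
  have := Fintype.ofFinite κ
  -- A trivial common kernel means that the functionals span the dual, so a basis extracted from
  -- them has the right size.
  have htop : Submodule.span ℝ (Set.range ((fun i : T => f i) ∘ a)) = ⊤ := by
    rw [hspan]
    apply Submodule.eq_top_of_finrank_eq
    have h1 := Subspace.finrank_add_finrank_dualCoannihilator_eq
      (Submodule.span ℝ (Set.range fun i : T => f i))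
    have h2 : (Submodule.span ℝ (Set.range fun i : T => f i)).dualCoannihilator = ⊥ := by
      rw [eq_bot_iff]
      intro y hy
      rw [Submodule.mem_dualCoannihilator] at hy
      exact h y fun i hi => hy _ (Submodule.subset_span ⟨⟨i, hi⟩, rfl⟩)
    rw [h2, finrank_bot, add_zero] at h1
    rw [h1, Subspace.dual_finrank_eq]
  refine ⟨Finset.univ.map ⟨fun k => (a k : ι), Subtype.val_injective.comp ha⟩, ?_, ?_, ?_⟩
  · have := finrank_span_eq_card hli
    rw [Finset.card_map, Finset.card_univ, ← this, htop, finrank_top, Subspace.dual_finrank_eq]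
  · intro i hi
    obtain ⟨k, -, rfl⟩ := Finset.mem_map.1 hi
    exact (a k).2
  · intro y hy
    rw [← Module.forall_dual_apply_eq_zero_iff ℝ]
    intro φ
    have hφ : φ ∈ Submodule.span ℝ (Set.range ((fun i : T => f i) ∘ a)) := htop ▸ trivial
    induction hφ using Submodule.span_induction with
    | mem φ hφ =>
      obtain ⟨k, rfl⟩ := hφ
      exact hy _ (Finset.mem_map.2 ⟨k, Finset.mem_univ _, rfl⟩)
    | zero => rfl
    | add φ ψ _ _ h₁ h₂ => simp [h₁, h₂]
    | smul r φ _ h₁ => simp [h₁]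

/-- A polyhedron given by `m` affine constraints in dimension `n` has at most `m.choose n`
extreme points. -/
theorem finite_and_ncard_extremePoints_le_choose {E ι : Type*} [AddCommGroup E] [Module ℝ E]
    [FiniteDimensional ℝ E] [Fintype ι] (f : ι → E →ₗ[ℝ] ℝ) (c : ι → ℝ) (T : Set ι) :
    (Set.extremePoints ℝ {x : E | (∀ i, f i x ≤ c i) ∧ ∀ i ∈ T, f i x = c i}).Finite ∧
    (Set.extremePoints ℝ {x : E | (∀ i, f i x ≤ c i) ∧ ∀ i ∈ T, f i x = c i}).ncard ≤
      (Fintype.card ι).choose (Module.finrank ℝ E) := by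
  classical
  have key : ∀ x : E, ∃ s : Finset ι,
      x ∈ Set.extremePoints ℝ {x : E | (∀ i, f i x ≤ c i) ∧ ∀ i ∈ T, f i x = c i} →
      s.card = Module.finrank ℝ E ∧ (∀ i ∈ s, f i x = c i) ∧
      ∀ y, (∀ i ∈ s, f i y = 0) → y = 0 := by
    intro x
    by_cases hx : x ∈ Set.extremePoints ℝ {x : E | (∀ i, f i x ≤ c i) ∧ ∀ i ∈ T, f i x = c i}
    · obtain ⟨s, h1, h2, h3⟩ := exists_finset_card_eq_finrank_of_separating f {i | f i x = c i}
        fun y hy => eq_zero_of_tight_of_mem_extremePoints f c T hx hy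
      exact ⟨s, fun _ => ⟨h1, fun i hi => h2 hi, h3⟩⟩
    · exact ⟨∅, fun h => (hx h).elim⟩
  choose s hs using key
  have hinj : Set.InjOn s
      (Set.extremePoints ℝ {x : E | (∀ i, f i x ≤ c i) ∧ ∀ i ∈ T, f i x = c i}) := by
    -- Two extreme points with the same selected constraints differ by a vector that these
    -- constraints annihilate.
    intro x hx y hy hxy
    refine sub_eq_zero.1 ((hs x hx).2.2 _ fun i hi => ?_)
    rw [map_sub, (hs x hx).2.1 i hi, (hs y hy).2.1 i (hxy ▸ hi), sub_self]
  have hmaps : ∀ x ∈ Set.extremePoints ℝ {x : E | (∀ i, f i x ≤ c i) ∧ ∀ i ∈ T, f i x = c i},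
      s x ∈ (↑(Finset.powersetCard (Module.finrank ℝ E) (Finset.univ : Finset ι)) :
        Set (Finset ι)) := fun x hx => by
    simpa [Finset.mem_powersetCard] using (hs x hx).1
  refine ⟨Set.Finite.of_injOn hmaps hinj (Finset.finite_toSet _), ?_⟩
  have := Set.ncard_le_ncard_of_injOn s hmaps hinj (Finset.finite_toSet _)
  rwa [Set.ncard_coe_finset, Finset.card_powersetCard, Finset.card_univ] at this

/-! ### The polytope of consistent signalings. -/

namespace SigBSG

variable {K M N : ℕ} (G : SigBSG K M N)

/-- The functional `π ↦ ∑ b, π (l, b) * w b`. -/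
noncomputable def blockSum (l : Fin K) (w : G.vertexBeliefs → ℝ) : G.Signaling →L[ℝ] ℝ :=
  ∑ b, w b • (EuclideanSpace.proj (l, b) : G.Signaling →L[ℝ] ℝ)

theorem blockSum_apply (l : Fin K) (w : G.vertexBeliefs → ℝ) (π : G.Signaling) :
    G.blockSum l w π = ∑ b, π (l, b) * w b := by
  simp [blockSum, mul_comm]

theorem U_eq_blockSum [NeZero N] (π : G.Signaling) (l k : Fin K) :
    G.U π l k = G.blockSum l (fun b => G.followerValue k b) π :=
  (G.blockSum_apply _ _ _).symm

theorem V_eq_blockSum [NeZero N] (π : G.Signaling) (l k : Fin K) :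
    G.V π l k = G.blockSum l (fun b => G.leaderValue k b) π :=
  (G.blockSum_apply _ _ _).symm

theorem mem_consistent_iff {π : G.Signaling} :
    π ∈ G.consistent ↔ (∀ k b, 0 ≤ π (k, b)) ∧ (∀ k, G.blockSum k 1 π = 1) ∧
      ∀ k l i, G.blockSum k (fun b => (b : Fin M → ℝ) i) π =
        G.blockSum l (fun b => (b : Fin M → ℝ) i) π := by
  simp only [consistent, Set.mem_ofPred_eq, blockSum_apply, Pi.one_apply, mul_one, forall_and]
  tauto

theorem isClosed_consistent : IsClosed G.consistent := by
  have : G.consistent = (⋂ k, ⋂ b, {π : G.Signaling | 0 ≤ π (k, b)}) ∩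
      ((⋂ k, {π | G.blockSum k 1 π = 1}) ∩ ⋂ k, ⋂ l, ⋂ i,
        {π | G.blockSum k (fun b => (b : Fin M → ℝ) i) π =
          G.blockSum l (fun b => (b : Fin M → ℝ) i) π}) := by
    ext π
    simp [mem_consistent_iff]
  rw [this]
  refine (isClosed_iInter fun k => isClosed_iInter fun b =>
    isClosed_le continuous_const (by fun_prop)).inter (IsClosed.inter ?_ ?_)
  · exact isClosed_iInter fun k => isClosed_eq (by fun_prop) continuous_const
  · exact isClosed_iInter fun k => isClosed_iInter fun l => isClosed_iInter fun i =>
      isClosed_eq (by fun_prop) (by fun_prop)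

theorem convex_consistent : Convex ℝ G.consistent := by
  intro x hx y hy a b ha hb hab
  rw [mem_consistent_iff] at *
  refine ⟨fun k c => ?_, fun k => ?_, fun k l i => ?_⟩
  · have := mul_nonneg ha (hx.1 k c)
    have := mul_nonneg hb (hy.1 k c)
    simp; linarith
  · simp only [map_add, map_smul, hx.2.1, hy.2.1, smul_eq_mul]; linarith
  · simp only [map_add, map_smul, hx.2.2 k l i, hy.2.2 k l i]

theorem le_one_of_mem_consistent {π : G.Signaling} (hπ : π ∈ G.consistent) (k : Fin K)
    (b : G.vertexBeliefs) : π (k, b) ≤ 1 := by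
  rw [← (hπ.1 k).2]
  exact Finset.single_le_sum (f := fun b => π (k, b)) (fun c _ => (hπ.1 k).1 c)
    (Finset.mem_univ b)

theorem isCompact_consistent : IsCompact G.consistent := by
  refine Metric.isCompact_of_isClosed_isBounded G.isClosed_consistent ?_
  rw [isBounded_iff_forall_norm_le]
  refine ⟨Real.sqrt (Fintype.card (Fin K × G.vertexBeliefs)), fun π hπ => ?_⟩
  rw [EuclideanSpace.norm_eq]
  refine Real.sqrt_le_sqrt ?_
  calc ∑ q, ‖π q‖ ^ 2 ≤ ∑ _q : Fin K × G.vertexBeliefs, (1 : ℝ) := by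
        refine Finset.sum_le_sum fun q _ => ?_
        have h0 : 0 ≤ π q := (hπ.1 q.1).1 q.2
        rw [Real.norm_of_nonneg h0]
        exact pow_le_one₀ h0 (G.le_one_of_mem_consistent hπ q.1 q.2)
    _ = _ := by simp

/-! ### Strata, faces and the number of candidates. -/

section faces

variable [NeZero N]

theorem mem_optimalReports {k l : Fin K} {π : G.Signaling} :
    l ∈ G.optimalReports k π ↔ ∀ l', G.U π l' k ≤ G.U π l k := by
  simp [optimalReports]

/-- The consistent signalings for which every report in `S k` is optimal for type `k`. -/
def face (S : Fin K → Finset (Fin K)) : Set G.Signaling :=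
  {π | π ∈ G.consistent ∧ ∀ k, S k ⊆ G.optimalReports k π}

/-- The consistent signalings for which `S k` is the set of optimal reports of type `k`. -/
def stratum (S : Fin K → Finset (Fin K)) : Set G.Signaling :=
  {π | π ∈ G.consistent ∧ ∀ k, G.optimalReports k π = S k}

theorem isClosed_face (S : Fin K → Finset (Fin K)) : IsClosed (G.face S) := by
  have : G.face S = G.consistent ∩ ⋂ k, ⋂ l ∈ S k, ⋂ l', {π | G.U π l' k ≤ G.U π l k} := by
    ext π
    simp [face, Finset.subset_iff, mem_optimalReports]
  rw [this]
  refine G.isClosed_consistent.inter (isClosed_iInter fun k => isClosed_biInter fun l _ =>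
    isClosed_iInter fun l' => ?_)
  simp only [U_eq_blockSum]
  exact isClosed_le (by fun_prop) (by fun_prop)

theorem nonempty_of_stratum_nonempty [NeZero K] {S : Fin K → Finset (Fin K)}
    (hS : (G.stratum S).Nonempty) (k : Fin K) : (S k).Nonempty := by
  obtain ⟨π, hπ⟩ := hS
  obtain ⟨l, hl⟩ := Finite.exists_max (fun l => G.U π l k)
  exact ⟨l, by rw [← hπ.2 k]; exact G.mem_optimalReports.2 hl⟩

theorem U_combo (x y : G.Signaling) (a b : ℝ) (l k : Fin K) :
    G.U (a • x + b • y) l k = a * G.U x l k + b * G.U y l k := by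
  simp [U_eq_blockSum]

/-- Every nonempty stratum is dense in the corresponding face. -/
theorem closure_stratum {S : Fin K → Finset (Fin K)}
    (hS : (G.stratum S).Nonempty) (hne : ∀ k, (S k).Nonempty) :
    closure (G.stratum S) = G.face S := by
  apply subset_antisymm
  · refine closure_minimal (fun π hπ => ⟨hπ.1, fun k => (hπ.2 k).ge⟩) (G.isClosed_face S)
  · intro x hx
    obtain ⟨y, hy⟩ := hS
    -- Reports outside `S k` are strictly suboptimal at `y`, and any positive weight on `y` keeps
    -- them so.
    have hmem : ∀ t ∈ Set.Ioc (0 : ℝ) 1, (1 - t) • x + t • y ∈ G.stratum S := by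
      intro t ht
      refine ⟨G.convex_consistent hx.1 hy.1 (by linarith [ht.2]) ht.1.le (by ring), fun k => ?_⟩
      have h1 : ∀ l ∈ S k, ∀ l', G.U x l' k ≤ G.U x l k := fun l hl =>
        G.mem_optimalReports.1 (hx.2 k hl)
      have h2 : ∀ l ∈ S k, ∀ l', G.U y l' k ≤ G.U y l k := fun l hl =>
        G.mem_optimalReports.1 (by rw [hy.2 k]; exact hl)
      have ht' : 0 ≤ 1 - t := by linarith [ht.2]
      ext l
      rw [mem_optimalReports]
      constructor
      · intro h
        obtain ⟨l₀, hl₀⟩ := hne k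
        have h3 := h l₀
        rw [U_combo, U_combo] at h3
        have h4 : G.U y l₀ k ≤ G.U y l k := by
          have := mul_le_mul_of_nonneg_left (h1 l₀ hl₀ l) ht'
          exact le_of_mul_le_mul_left (by linarith) ht.1
        rw [← hy.2 k, mem_optimalReports]
        exact fun l' => (h2 l₀ hl₀ l').trans h4
      · intro hl l'
        rw [U_combo, U_combo]
        exact add_le_add (mul_le_mul_of_nonneg_left (h1 l hl l') ht')
          (mul_le_mul_of_nonneg_left (h2 l hl l') ht.1.le)
    have hlim : Filter.Tendsto (fun t : ℝ => (1 - t) • x + t • y)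
        (nhdsWithin 0 (Set.Ioi 0)) (nhds x) := by
      have : Continuous (fun t : ℝ => (1 - t) • x + t • y) := by fun_prop
      simpa using (this.tendsto 0).mono_left nhdsWithin_le_nhds
    exact mem_closure_of_tendsto hlim
      (Filter.mem_of_superset (Ioc_mem_nhdsGT one_pos) hmem)

/-- The loss from reporting `l` instead of a fixed `l₀ ∈ T k` is linear and nonnegative on the
larger face, so if it vanishes inside a segment it vanishes at the endpoints. -/
theorem isExtreme_face {S T : Fin K → Finset (Fin K)} (hT : ∀ k, (T k).Nonempty)
    (hTS : ∀ k, T k ⊆ S k) : IsExtreme ℝ (G.face T) (G.face S) := by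
  refine ⟨fun π hπ => ⟨hπ.1, fun k => (hTS k).trans (hπ.2 k)⟩, ?_⟩
  rintro x hx y hy z hz ⟨a, b, ha, hb, -, rfl⟩
  refine ⟨hx.1, fun k l hl => G.mem_optimalReports.2 fun l' => ?_⟩
  obtain ⟨l₀, hl₀⟩ := hT k
  have h1 := G.mem_optimalReports.1 (hx.2 k hl₀)
  have h2 := G.mem_optimalReports.1 (hy.2 k hl₀)
  have h3 := G.mem_optimalReports.1 (hz.2 k hl) l₀
  rw [U_combo, U_combo] at h3
  have h4 : G.U x l₀ k ≤ G.U x l k := by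
    have := mul_le_mul_of_nonneg_left (h2 l) hb.le
    exact le_of_mul_le_mul_left (by linarith) ha
  exact (h1 l').trans h4

/-- The closed region may fail to be convex, but it is a finite union of closed strata. Since the
tie-breaking rule selects an element of `S k`, each of these is a face of the one polytope attached
to `γ`. -/
theorem extremePoints_closure_region_subset [NeZero K] (γ : Fin K → Fin K) :
    Set.extremePoints ℝ (closure (G.region γ)) ⊆
      Set.extremePoints ℝ (G.face fun k => {γ k}) := by
  intro v hv
  have hreg : G.region γ = ⋃ S : {S : Fin K → Finset (Fin K) // ∀ k, G.tie k (S k) = γ k},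
      G.stratum S := by
    ext π
    simp only [region, report, stratum, Set.mem_ofPred_eq, Set.mem_iUnion, Subtype.exists,
      exists_prop]
    constructor
    · exact fun h => ⟨fun k => G.optimalReports k π, h.2, h.1, fun _ => rfl⟩
    · rintro ⟨S, h1, h2, h3⟩
      exact ⟨h2, fun k => by rw [h3, h1]⟩
  have hcl : closure (G.region γ) =
      ⋃ S : {S : Fin K → Finset (Fin K) // ∀ k, G.tie k (S k) = γ k},
        closure (G.stratum S) := by
    rw [hreg, closure_iUnion_of_finite]
  obtain ⟨S, hS⟩ := Set.mem_iUnion.1 (hcl ▸ hv.1)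
  have hne : (G.stratum S).Nonempty := closure_nonempty_iff.1 ⟨v, hS⟩
  have hSne := G.nonempty_of_stratum_nonempty hne
  -- An extreme point of a union is extreme in any piece that contains it.
  have h1 : v ∈ Set.extremePoints ℝ (closure (G.stratum S)) :=
    inter_extremePoints_subset_extremePoints_of_subset
      (hcl ▸ Set.subset_iUnion (fun S : {S : Fin K → Finset (Fin K) //
        ∀ k, G.tie k (S k) = γ k} => closure (G.stratum S)) S) ⟨hS, hv⟩
  rw [G.closure_stratum hne hSne] at h1
  refine (G.isExtreme_face (fun k => Finset.singleton_nonempty _)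
    fun k => ?_).extremePoints_subset_extremePoints h1
  rw [Finset.singleton_subset_iff, ← S.2 k]
  exact G.tie_mem k _ (hSne k)

/-- The polytope on which reporting `γ k` is optimal for every type `k` has few vertices. -/
theorem finite_and_ncard_extremePoints_face_le [NeZero K] (γ : Fin K → Fin K) :
    (Set.extremePoints ℝ (G.face fun k => {γ k})).Finite ∧
    (Set.extremePoints ℝ (G.face fun k => {γ k})).ncard ≤
      (K * G.vertexBeliefs.ncard + K * K + (K + K * M)).choose
        (K * G.vertexBeliefs.ncard) := by
  -- Nonnegativity, optimality of `γ k`, normalization, and equality of means with type `0`. Each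
  -- equation is a single constraint, declared tight through `Set.range Sum.inr`.
  let f : ((Fin K × G.vertexBeliefs) ⊕ (Fin K × Fin K)) ⊕ (Fin K ⊕ (Fin K × Fin M)) →
      (G.Signaling →ₗ[ℝ] ℝ) :=
    Sum.elim
      (Sum.elim (fun q => -(EuclideanSpace.proj q : G.Signaling →L[ℝ] ℝ).toLinearMap)
        (fun q => (G.blockSum q.2 (fun b => G.followerValue q.1 b)).toLinearMap -
          (G.blockSum (γ q.1) (fun b => G.followerValue q.1 b)).toLinearMap))
      (Sum.elim (fun k => (G.blockSum k 1).toLinearMap)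
        (fun q => (G.blockSum q.1 (fun b => (b : Fin M → ℝ) q.2)).toLinearMap -
          (G.blockSum 0 (fun b => (b : Fin M → ℝ) q.2)).toLinearMap))
  let c : ((Fin K × G.vertexBeliefs) ⊕ (Fin K × Fin K)) ⊕ (Fin K ⊕ (Fin K × Fin M)) → ℝ :=
    Sum.elim (fun _ => 0) (Sum.elim (fun _ => 1) (fun _ => 0))
  have h : (G.face fun k => {γ k}) =
      {π | (∀ i, f i π ≤ c i) ∧ ∀ i ∈ Set.range Sum.inr, f i π = c i} := by
    ext π
    simp only [face, Set.mem_ofPred_eq, mem_consistent_iff, Finset.singleton_subset_iff,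
      mem_optimalReports, U_eq_blockSum, Set.forall_mem_range, Sum.forall, f, c, Sum.elim_inl,
      Sum.elim_inr, Prod.forall, LinearMap.neg_apply, LinearMap.sub_apply,
      ContinuousLinearMap.coe_coe, PiLp.proj_apply, sub_nonpos, sub_eq_zero,
      Left.neg_nonpos_iff]
    constructor
    · rintro ⟨⟨h1, h2, h3⟩, h4⟩
      exact ⟨⟨⟨h1, h4⟩, fun k => (h2 k).le, fun k i => (h3 k 0 i).le⟩, h2, fun k i => h3 k 0 i⟩
    · rintro ⟨⟨⟨h1, h4⟩, -⟩, h2, h3⟩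
      exact ⟨⟨h1, h2, fun k l i => (h3 k i).trans (h3 l i).symm⟩, h4⟩
  have key := finite_and_ncard_extremePoints_le_choose f c (Set.range Sum.inr)
  rw [← h] at key
  have hX : Fintype.card G.vertexBeliefs = G.vertexBeliefs.ncard := by
    rw [← Nat.card_coe_set_eq, Nat.card_eq_fintype_card]
  simpa [hX] using key

theorem finite_candidates [NeZero K] (sel : (Fin K → Fin K) → G.Signaling → G.Signaling) :
    (G.candidates sel).Finite ∧ (G.candidates sel).ncard ≤
      K ^ K * (K * G.vertexBeliefs.ncard + K * K + (K + K * M)).choose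
        (K * G.vertexBeliefs.ncard) := by
  have h : G.candidates sel =
      ⋃ γ : Fin K → Fin K, sel γ '' Set.extremePoints ℝ (closure (G.region γ)) := by
    ext π
    simp only [candidates, Set.mem_ofPred_eq, Set.mem_iUnion, Set.mem_image, eq_comm (a := π)]
  have hfin := fun γ => (G.finite_and_ncard_extremePoints_face_le γ).1.subset
    (G.extremePoints_closure_region_subset γ)
  rw [h]
  refine ⟨Set.finite_iUnion fun γ => (hfin γ).image _,
    (Set.ncard_iUnion_le_of_fintype _).trans ?_⟩
  refine (Finset.sum_le_card_nsmul _ _ ((K * G.vertexBeliefs.ncard + K * K + (K + K * M)).choose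
    (K * G.vertexBeliefs.ncard)) fun γ _ => ?_).trans (le_of_eq (by simp))
  exact (Set.ncard_image_le (hfin γ)).trans
    ((Set.ncard_le_ncard (G.extremePoints_closure_region_subset γ)
      (G.finite_and_ncard_extremePoints_face_le γ).1).trans
      (G.finite_and_ncard_extremePoints_face_le γ).2)

end faces

end SigBSG

/-! ### Constant signalings and blocks. -/

/-- The vertices of the standard simplex are extreme points. -/
theorem single_mem_extremePoints_stdSimplex {ι : Type*} [Fintype ι] [DecidableEq ι] (i : ι) :
    (Pi.single i 1 : ι → ℝ) ∈ Set.extremePoints ℝ (stdSimplex ℝ ι) := by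
  refine ⟨single_mem_stdSimplex ℝ i, ?_⟩
  rintro x hx y hy ⟨a, b, ha, hb, -, hab⟩
  have h0 : ∀ j, j ≠ i → x j = 0 := by
    intro j hj
    have h1 := congrFun hab j
    simp only [Pi.add_apply, Pi.smul_apply, smul_eq_mul, Pi.single_eq_of_ne hj] at h1
    have h2 := mul_nonneg ha.le (hx.1 j)
    have h3 := mul_nonneg hb.le (hy.1 j)
    exact (mul_eq_zero.1 (by linarith : a * x j = 0)).resolve_left ha.ne'
  funext j
  by_cases hj : j = i
  · subst hj
    rw [Pi.single_eq_same, ← hx.2, Finset.sum_eq_single j (fun l _ hl => h0 l hl) (by simp)]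
  · rw [h0 j hj, Pi.single_eq_of_ne hj]

namespace SigBSG

variable {K M N : ℕ} (G : SigBSG K M N)

theorem exists_prior_pos : ∃ k, 0 < G.prior k := by
  by_contra! h
  have := Finset.sum_nonpos fun k (_ : k ∈ Finset.univ) => h k
  rw [G.prior_mem.2] at this
  linarith

theorem neZero_types (G : SigBSG K M N) : NeZero K :=
  let ⟨k, _⟩ := G.exists_prior_pos
  ⟨by rintro rfl; exact k.elim0⟩

theorem sum_prior_mul_le {x : Fin K → ℝ} {r : ℝ} (h : ∀ k, x k ≤ r) :
    ∑ k, G.prior k * x k ≤ r :=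
  calc ∑ k, G.prior k * x k ≤ ∑ k, G.prior k * r :=
        Finset.sum_le_sum fun k _ => mul_le_mul_of_nonneg_left (h k) (G.prior_mem.1 k)
    _ = r := by rw [← Finset.sum_mul, G.prior_mem.2, one_mul]

/-- A mean equal to an upper bound forces equality for every type of positive probability. -/
theorem eq_of_le_sum_prior_mul {x : Fin K → ℝ} {r : ℝ} (h : ∀ k, x k ≤ r)
    (hr : r ≤ ∑ k, G.prior k * x k) {k : Fin K} (hk : 0 < G.prior k) : x k = r := by
  by_contra hne
  have hlt : ∑ k, G.prior k * x k < ∑ k, G.prior k * r :=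
    Finset.sum_lt_sum (fun k _ => mul_le_mul_of_nonneg_left (h k) (G.prior_mem.1 k))
      ⟨k, Finset.mem_univ k, mul_lt_mul_of_pos_left (lt_of_le_of_ne (h k) hne) hk⟩
  rw [← Finset.sum_mul, G.prior_mem.2, one_mul] at hlt
  linarith

/-- The signaling that induces the belief `b` under every report. -/
noncomputable def constSignaling (b : G.vertexBeliefs) : G.Signaling := by
  classical exact WithLp.toLp 2 fun q => (Pi.single b 1 : G.vertexBeliefs → ℝ) q.2

theorem blockSum_constSignaling (l : Fin K) (w : G.vertexBeliefs → ℝ) (b : G.vertexBeliefs) :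
    G.blockSum l w (G.constSignaling b) = w b := by
  classical
  simp [blockSum_apply, constSignaling, Pi.single_apply]

/-- The part of a signaling used by those who report `l`. -/
noncomputable def block (l : Fin K) (π : G.Signaling) : EuclideanSpace ℝ G.vertexBeliefs :=
  WithLp.toLp 2 fun b => π (l, b)

theorem sum_norm_sq_block (π : G.Signaling) : ∑ l, ‖G.block l π‖ ^ 2 = ‖π‖ ^ 2 := by
  simp only [EuclideanSpace.norm_sq_eq, block, Fintype.sum_prod_type]

theorem norm_block_le (l : Fin K) (π : G.Signaling) : ‖G.block l π‖ ≤ ‖π‖ := by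
  refine le_of_sq_le_sq ?_ (norm_nonneg _)
  rw [← sum_norm_sq_block]
  exact Finset.single_le_sum (f := fun l => ‖G.block l π‖ ^ 2) (fun _ _ => by positivity)
    (Finset.mem_univ l)

theorem constSignaling_mem_extremePoints (b : G.vertexBeliefs) :
    G.constSignaling b ∈ Set.extremePoints ℝ G.consistent := by
  classical
  have hb : ∀ k c, G.constSignaling b (k, c) = (Pi.single b 1 : G.vertexBeliefs → ℝ) c :=
    fun k c => by simp [constSignaling]
  constructor
  · rw [mem_consistent_iff]
    simp only [blockSum_constSignaling, hb, Pi.one_apply, implies_true, and_true]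
    exact fun _ c => (single_mem_stdSimplex ℝ b).1 c
  · rintro x hx y hy ⟨s, t, hs, ht, hst, h⟩
    ext ⟨k, c⟩
    have := (single_mem_extremePoints_stdSimplex b).2 (x₁ := fun c => x (k, c))
      (x₂ := fun c => y (k, c)) (hx.1 k) (hy.1 k) ⟨s, t, hs, ht, hst, ?_⟩
    · rw [hb, ← this]
    · funext c
      rw [← hb k c, ← h]
      simp

/-- Blocks are orthogonal: two of norm `δ` would give `2 * δ ^ 2 ≤ ‖d‖ ^ 2`. -/
theorem block_unique {δ : ℝ} (hδ : 0 < δ) {d : G.Signaling} (hd : ‖d‖ ≤ δ) {l l' : Fin K}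
    (h : ‖G.block l d‖ = δ) (h' : ‖G.block l' d‖ = δ) : l = l' := by
  by_contra hne
  have h1 : ∑ i ∈ {l, l'}, ‖G.block i d‖ ^ 2 ≤ ∑ i, ‖G.block i d‖ ^ 2 :=
    Finset.sum_le_sum_of_subset_of_nonneg (Finset.subset_univ _) fun _ _ _ => by positivity
  rw [sum_norm_sq_block, Finset.sum_pair hne, h, h'] at h1
  have := pow_le_pow_left₀ (norm_nonneg _) hd 2
  have := pow_pos hδ 2
  linarith

/-! ### The supremum at a vertex and the loss at a candidate. -/

section

variable [NeZero N]

/-- Pure beliefs are vertices. -/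
theorem single_mem_vertexBeliefs (i : Fin M) :
    (Pi.single i 1 : Fin M → ℝ) ∈ G.vertexBeliefs := by
  choose j hj _ using fun k => G.exists_favorable_response k (Pi.single i 1 : Fin M → ℝ)
  refine Set.mem_iUnion.2 ⟨j, ?_⟩
  have h := single_mem_extremePoints_stdSimplex i
  exact inter_extremePoints_subset_extremePoints_of_subset
    (fun b hb => hb.1) ⟨⟨h.1, hj⟩, h⟩

/-- This absorbs the `K * M` mean constraints into a multiple of `K * G.vertexBeliefs.ncard`. -/
theorem actions_le_ncard_vertexBeliefs : M ≤ G.vertexBeliefs.ncard := by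
  have h := Set.ncard_le_ncard_of_injOn (s := Set.univ) (t := G.vertexBeliefs)
    (fun i : Fin M => (Pi.single i 1 : Fin M → ℝ))
    (fun i _ => G.single_mem_vertexBeliefs i)
    (fun i _ j _ hij => by
      by_contra hne
      have := congrFun hij i
      simp [hne] at this) G.finite_vertexBeliefs
  simpa using h

/-- The leader's expected utility if type `k` reports `γ k`. -/
noncomputable def regionUtility (γ : Fin K → Fin K) : G.Signaling →L[ℝ] ℝ :=
  ∑ k, G.prior k • G.blockSum (γ k) (fun b => G.leaderValue k b)

theorem regionUtility_apply (γ : Fin K → Fin K) (π : G.Signaling) :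
    G.regionUtility γ π =
      ∑ k, G.prior k * G.blockSum (γ k) (fun b => G.leaderValue k b) π := by
  simp [regionUtility]

theorem leaderUtility_eq_regionUtility {γ : Fin K → Fin K} {π : G.Signaling}
    (h : ∀ k, G.report k π = γ k) : G.leaderUtility π = G.regionUtility γ π := by
  simp [regionUtility_apply, leaderUtility, V_eq_blockSum, h]

theorem mem_region_report {π : G.Signaling} (h : π ∈ G.consistent) :
    π ∈ G.region fun k => G.report k π := ⟨h, fun _ => rfl⟩

theorem closure_region_subset (γ : Fin K → Fin K) : closure (G.region γ) ⊆ G.consistent :=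
  closure_minimal (fun _ h => h.1) G.isClosed_consistent

/-- The closure of a nonempty region has an extreme point that maximizes `regionUtility`. -/
theorem exists_extremePoint_ge {γ : Fin K → Fin K} {π : G.Signaling} (hπ : π ∈ G.region γ) :
    ∃ v ∈ Set.extremePoints ℝ (closure (G.region γ)),
      G.regionUtility γ π ≤ G.regionUtility γ v := by
  -- Convexity is not needed: the maximizers form a compact exposed subset, whose extreme points are
  -- extreme in the closure.
  have hc : IsCompact (closure (G.region γ)) :=
    G.isCompact_consistent.of_isClosed_subset isClosed_closure (G.closure_region_subset γ)
  have hexp : IsExposed ℝ (closure (G.region γ))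
      ((G.regionUtility γ).toExposed (closure (G.region γ))) :=
    ContinuousLinearMap.toExposed.isExposed
  obtain ⟨m, hm, hmax⟩ := hc.exists_isMaxOn ⟨π, subset_closure hπ⟩
    (G.regionUtility γ).continuous.continuousOn
  obtain ⟨v, hv⟩ := (hexp.isCompact hc).extremePoints_nonempty ⟨m, hm, hmax⟩
  exact ⟨v, hexp.isExtreme.extremePoints_subset_extremePoints hv,
    hv.1.2 π (subset_closure hπ)⟩

/-- The supremum of the leader's utility is the value of some `regionUtility γ` at a vertex of the
closure of the region of `γ`. -/
theorem exists_isLUB_vertex [NeZero M] :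
    ∃ γ, ∃ v ∈ Set.extremePoints ℝ (closure (G.region γ)),
      IsLUB (G.leaderUtility '' G.consistent) (G.regionUtility γ v) := by
  have := G.neZero_types
  let E : Set ((Fin K → Fin K) × G.Signaling) :=
    {p | p.2 ∈ Set.extremePoints ℝ (closure (G.region p.1))}
  have hE : E.Finite := by
    have : E ⊆ ⋃ γ : Fin K → Fin K,
        Prod.mk γ '' Set.extremePoints ℝ (G.face fun k => {γ k}) := fun p hp =>
      Set.mem_iUnion.2 ⟨p.1, p.2, G.extremePoints_closure_region_subset p.1 hp, rfl⟩
    exact (Set.finite_iUnion fun γ =>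
      (G.finite_and_ncard_extremePoints_face_le γ).1.image _).subset this
  have hne : E.Nonempty := by
    have h := (G.constSignaling_mem_extremePoints ⟨_, G.single_mem_vertexBeliefs 0⟩).1
    obtain ⟨v, hv, -⟩ := G.exists_extremePoint_ge (G.mem_region_report h)
    exact ⟨(_, v), hv⟩
  obtain ⟨p, hp, hmax⟩ := Set.exists_max_image E (fun p => G.regionUtility p.1 p.2) hE hne
  refine ⟨p.1, p.2, hp, ?_, fun u hu => ?_⟩
  · rintro _ ⟨π, hπ, rfl⟩
    obtain ⟨v, hv, hle⟩ := G.exists_extremePoint_ge (G.mem_region_report hπ)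
    rw [G.leaderUtility_eq_regionUtility fun _ => rfl]
    exact hle.trans (hmax (_, v) hv)
  -- The vertex need not lie in the region, but bounds on the functional pass to the closure.
  · have hsub : closure (G.region p.1) ⊆ {π | G.regionUtility p.1 π ≤ u} := by
      refine closure_minimal (fun π hπ => ?_)
        (isClosed_le (G.regionUtility p.1).continuous continuous_const)
      have := hu ⟨π, hπ.1, rfl⟩
      rwa [G.leaderUtility_eq_regionUtility hπ.2] at this
    exact hsub hp.1

theorem exists_isVertexSelection {δ : ℝ} (hδ : 0 < δ) : ∃ sel, G.IsVertexSelection δ sel := by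
  have : ∀ γ v, ∃ π : G.Signaling, v ∈ closure (G.region γ) →
      (v ∈ G.region γ → π = v) ∧ (v ∉ G.region γ → π ∈ G.region γ ∧ ‖v - π‖ ≤ δ) := by
    intro γ v
    by_cases hv : v ∈ G.region γ
    · exact ⟨v, fun _ => ⟨fun _ => rfl, fun h => (h hv).elim⟩⟩
    · by_cases hc : v ∈ closure (G.region γ)
      · obtain ⟨π, hπ, hd⟩ := Metric.mem_closure_iff.1 hc δ hδ
        exact ⟨π, fun _ => ⟨fun h => (hv h).elim, fun _ => ⟨hπ, by
          rw [← dist_eq_norm]; exact hd.le⟩⟩⟩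
      · exact ⟨v, fun h => (hc h).elim⟩
  choose sel hsel using this
  exact ⟨sel, fun γ v hv => hsel γ v hv.1⟩

theorem IsVertexSelection.mem_region {δ : ℝ} {sel : (Fin K → Fin K) → G.Signaling → G.Signaling}
    (h : G.IsVertexSelection δ sel) {γ : Fin K → Fin K} {v : G.Signaling}
    (hv : v ∈ Set.extremePoints ℝ (closure (G.region γ))) : sel γ v ∈ G.region γ := by
  by_cases hr : v ∈ G.region γ
  · rwa [(h γ v hv).1 hr]
  · exact ((h γ v hv).2 hr).1

/-- Extreme in the whole polytope, it is extreme in the closure of its own region; as it lies in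
that region, every selection keeps it unchanged. -/
theorem constSignaling_mem_candidates {δ : ℝ}
    {sel : (Fin K → Fin K) → G.Signaling → G.Signaling}
    (h : G.IsVertexSelection δ sel) (b : G.vertexBeliefs) :
    G.constSignaling b ∈ G.candidates sel := by
  have hx := G.constSignaling_mem_extremePoints b
  have hr := G.mem_region_report hx.1
  have hv := inter_extremePoints_subset_extremePoints_of_subset
    (G.closure_region_subset _) ⟨subset_closure hr, hx⟩
  exact ⟨_, _, hv, ((h _ _ hv).1 hr).symm⟩

theorem blockSum_eq_inner (l k : Fin K) (π : G.Signaling) :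
    G.blockSum l (fun b => G.leaderValue k b) π = inner ℝ (G.valueVector k) (G.block l π) := by
  simp [blockSum_apply, valueVector, block, PiLp.inner_apply]

theorem blockSum_le {ε δ : ℝ} {d : G.Signaling} (hd : ‖d‖ ≤ δ) {k : Fin K}
    (hk : δ * ‖G.valueVector k‖ ≤ ε) (l : Fin K) :
    G.blockSum l (fun b => G.leaderValue k b) d ≤ ε := by
  rw [blockSum_eq_inner]
  refine (real_inner_le_norm _ _).trans (le_trans ?_ hk)
  rw [mul_comm]
  exact mul_le_mul_of_nonneg_right ((G.norm_block_le l d).trans hd) (norm_nonneg _)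

/-- If the bound of `blockSum_le` is attained, then the value vector is proportional to the block
and the block carries all of the norm. -/
theorem eq_smul_block_of_blockSum_eq {ε δ : ℝ} (hε : 0 < ε) (hδ : 0 < δ) {d : G.Signaling}
    (hd : ‖d‖ ≤ δ) {k l : Fin K} (hk : δ * ‖G.valueVector k‖ ≤ ε)
    (h : G.blockSum l (fun b => G.leaderValue k b) d = ε) :
    G.valueVector k = (ε / δ ^ 2) • G.block l d ∧ ‖G.block l d‖ = δ := by
  rw [blockSum_eq_inner] at h
  have h1 := (G.norm_block_le l d).trans hd
  have h2 := real_inner_le_norm (G.valueVector k) (G.block l d)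
  rw [h] at h2
  have hV : ‖G.valueVector k‖ ≤ ε / δ := by rwa [le_div_iff₀' hδ]
  have hB : ‖G.block l d‖ = δ := by
    refine le_antisymm h1 (not_lt.1 fun hlt => ?_)
    have h3 : 0 < ‖G.valueVector k‖ := by
      by_contra! h0
      have : ‖G.valueVector k‖ = 0 := le_antisymm h0 (norm_nonneg _)
      rw [this, zero_mul] at h2
      linarith
    have := mul_lt_mul_of_pos_left hlt h3
    linarith
  refine ⟨?_, hB⟩
  -- Equality in Cauchy–Schwarz: expanding the square of the difference gives a nonpositive number.
  rw [← sub_eq_zero, ← norm_eq_zero, ← sq_eq_zero_iff]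
  refine le_antisymm ?_ (sq_nonneg _)
  rw [norm_sub_sq_real, inner_smul_right, h, norm_smul, mul_pow, hB, Real.norm_eq_abs, sq_abs]
  have h4 : ‖G.valueVector k‖ ^ 2 ≤ (ε / δ) ^ 2 := pow_le_pow_left₀ (norm_nonneg _) hV 2
  have h5 : (ε / δ) ^ 2 - 2 * (ε / δ ^ 2 * ε) + (ε / δ ^ 2) ^ 2 * δ ^ 2 = 0 := by
    field_simp
    ring
  linarith

/-- If all types of positive probability have the same leader values, then inducing one best belief
is optimal for the leader. -/
theorem exists_constSignaling_optimal [NeZero M] {w : G.vertexBeliefs → ℝ}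
    (hw : ∀ k, 0 < G.prior k → ∀ b : G.vertexBeliefs, G.leaderValue k b = w b) :
    ∃ b : G.vertexBeliefs, ∀ π ∈ G.consistent,
      G.leaderUtility π ≤ G.leaderUtility (G.constSignaling b) := by
  have : Nonempty G.vertexBeliefs := ⟨⟨_, G.single_mem_vertexBeliefs 0⟩⟩
  obtain ⟨b, hb⟩ := Finite.exists_max w
  have hval : ∀ π, G.leaderUtility π = ∑ k, G.prior k * G.blockSum (G.report k π) w π := by
    intro π
    refine Finset.sum_congr rfl fun k _ => ?_
    rcases (G.prior_mem.1 k).eq_or_lt with h | h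
    · simp [← h]
    · rw [V_eq_blockSum, funext (hw k h)]
  refine ⟨b, fun π hπ => ?_⟩
  rw [hval (G.constSignaling b)]
  simp only [blockSum_constSignaling]
  rw [← Finset.sum_mul, G.prior_mem.2, one_mul, hval]
  refine G.sum_prior_mul_le fun k => ?_
  rw [blockSum_apply]
  calc ∑ c, π (G.report k π, c) * w c ≤ ∑ c, π (G.report k π, c) * w b :=
        Finset.sum_le_sum fun c _ => mul_le_mul_of_nonneg_left (hb c) ((hπ.1 _).1 c)
    _ = w b := by rw [← Finset.sum_mul, (hπ.1 _).2, one_mul]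

theorem candidates_subset_consistent {δ : ℝ}
    {sel : (Fin K → Fin K) → G.Signaling → G.Signaling}
    (h : G.IsVertexSelection δ sel) : G.candidates sel ⊆ G.consistent := by
  rintro _ ⟨γ, v, hv, rfl⟩
  exact (h.mem_region G hv).1

/-- Some candidate is within `ε` of the supremum. -/
theorem exists_candidate_near [NeZero M] {ε δ : ℝ} (hε : 0 < ε) (hδ : 0 < δ)
    (hV : ∀ k, δ * ‖G.valueVector k‖ ≤ ε)
    {sel : (Fin K → Fin K) → G.Signaling → G.Signaling} (h : G.IsVertexSelection δ sel) {s : ℝ}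
    (hs : IsLUB (G.leaderUtility '' G.consistent) s) :
    ∃ π ∈ G.candidates sel, s - G.leaderUtility π < ε := by
  obtain ⟨γ, v, hv, hlub⟩ := G.exists_isLUB_vertex
  obtain rfl := hs.unique hlub
  have hcand : sel γ v ∈ G.candidates sel := ⟨γ, v, hv, rfl⟩
  by_cases hlt : G.regionUtility γ v - G.leaderUtility (sel γ v) < ε
  · exact ⟨_, hcand, hlt⟩
  have hreg := h.mem_region G hv
  rw [G.leaderUtility_eq_regionUtility hreg.2, ← map_sub, not_lt] at hlt
  have hnot : v ∉ G.region γ := by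
    intro hr
    rw [(h γ v hv).1 hr, sub_self, map_zero] at hlt
    linarith
  have hd := ((h γ v hv).2 hnot).2
  rw [regionUtility_apply] at hlt
  -- Each type contributes at most `ε` to an average that is at least `ε`, so every type of positive
  -- probability attains its bound.
  have heq := fun k (hk : 0 < G.prior k) =>
    G.eq_smul_block_of_blockSum_eq hε hδ hd (hV k)
      (G.eq_of_le_sum_prior_mul (fun k => G.blockSum_le hd (hV k) (γ k)) hlt hk)
  obtain ⟨k₀, hk₀⟩ := G.exists_prior_pos
  have hw : ∀ k, 0 < G.prior k → ∀ b : G.vertexBeliefs,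
      G.leaderValue k b = G.leaderValue k₀ b := by
    intro k hk b
    have hval : G.valueVector k = G.valueVector k₀ := by
      rw [(heq k hk).1, (heq k₀ hk₀).1, G.block_unique hδ hd (heq k hk).2 (heq k₀ hk₀).2]
    exact congrArg (fun x : EuclideanSpace ℝ G.vertexBeliefs => x b) hval
  obtain ⟨b, hb⟩ := G.exists_constSignaling_optimal hw
  refine ⟨_, G.constSignaling_mem_candidates h b, ?_⟩
  have : G.regionUtility γ v ≤ G.leaderUtility (G.constSignaling b) :=
    hs.2 (by rintro _ ⟨π, hπ, rfl⟩; exact hb π hπ)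
  linarith

end

end SigBSG

/-! ### The number of vertex beliefs and numerical estimates. -/

namespace SigBSG

variable {K M N : ℕ} (G : SigBSG K M N)

/-- There are `N ^ K` cells, each cut out in dimension `M` by `M` sign conditions, one equation and
`K * N` best-response inequalities. -/
theorem ncard_vertexBeliefs_le :
    G.vertexBeliefs.ncard ≤ N ^ K * (M + 1 + K * N).choose M := by
  let pay : Fin K → Fin N → ((Fin M → ℝ) →ₗ[ℝ] ℝ) := fun k a =>
    ∑ i, G.F k i a • (LinearMap.proj i : (Fin M → ℝ) →ₗ[ℝ] ℝ)
  have hpay : ∀ k a b, pay k a b = G.followerPayoff k b a := fun k a b => by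
    simp [pay, followerPayoff, mul_comm]
  have hcell : ∀ j, (Set.extremePoints ℝ (G.cell j)).ncard ≤ (M + 1 + K * N).choose M := by
    intro j
    let f : (Fin M ⊕ Unit) ⊕ (Fin K × Fin N) → ((Fin M → ℝ) →ₗ[ℝ] ℝ) :=
      Sum.elim (Sum.elim (fun i => -(LinearMap.proj i : (Fin M → ℝ) →ₗ[ℝ] ℝ))
        (fun _ => ∑ i, (LinearMap.proj i : (Fin M → ℝ) →ₗ[ℝ] ℝ)))
        (fun p => pay p.1 p.2 - pay p.1 (j p.1))
    let c : (Fin M ⊕ Unit) ⊕ (Fin K × Fin N) → ℝ :=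
      Sum.elim (Sum.elim (fun _ => 0) (fun _ => 1)) (fun _ => 0)
    have h : G.cell j =
        {b | (∀ q, f q b ≤ c q) ∧ ∀ q ∈ ({Sum.inl (Sum.inr ())} : Set _), f q b = c q} := by
      ext b
      simp only [cell, brSet, stdSimplex, Set.mem_ofPred_eq, Sum.forall, f, c, Sum.elim_inl,
        Sum.elim_inr, Prod.forall, Set.mem_singleton_iff, forall_eq, LinearMap.neg_apply,
        LinearMap.sub_apply, LinearMap.proj_apply, LinearMap.sum_apply, hpay, sub_nonpos,
        Left.neg_nonpos_iff, forall_const]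
      constructor
      · rintro ⟨⟨h1, h2⟩, h3⟩
        exact ⟨⟨⟨h1, h2.le⟩, h3⟩, h2⟩
      · rintro ⟨⟨⟨h1, -⟩, h3⟩, h2⟩
        exact ⟨⟨h1, h2⟩, h3⟩
    have key := (finite_and_ncard_extremePoints_le_choose f c {Sum.inl (Sum.inr ())}).2
    rw [← h] at key
    simpa using key
  refine (Set.ncard_iUnion_le_of_fintype _).trans ?_
  refine (Finset.sum_le_card_nsmul _ _ _ fun j _ => hcell j).trans (le_of_eq ?_)
  simp

end SigBSG

/-- `A ^ K` times a polynomial in `K` is eventually below `K ^ (K + 1)`. -/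
theorem four_mul_pow_mul_choose_le (M N K : ℕ) (h1 : 2 * (M + 1) ≤ K)
    (h2 : (4 * (N + 1) ^ 2) ^ 2 ≤ K) :
    4 * (N ^ K * (M + 1 + K * N).choose M) ≤ K ^ (K + 1) := by
  have h3 : (M + 1 + K * N).choose M ≤ (K * (N + 1)) ^ M :=
    (Nat.choose_le_pow _ _).trans (Nat.pow_le_pow_left (by nlinarith) M)
  have h4 : N ^ K ≤ (N + 1) ^ K := Nat.pow_le_pow_left (by omega) K
  have h5 : (N + 1) ^ M ≤ (N + 1) ^ K := Nat.pow_le_pow_right (by omega) (by omega)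
  have h6 : (4 * (N + 1) ^ 2) ^ K ≤ K ^ (K + 1 - M) :=
    -- `h1` gives `K ≤ 2 * (K + 1 - M)`.
    calc (4 * (N + 1) ^ 2) ^ K ≤ (4 * (N + 1) ^ 2) ^ (2 * (K + 1 - M)) :=
          Nat.pow_le_pow_right (by positivity) (by omega)
      _ = ((4 * (N + 1) ^ 2) ^ 2) ^ (K + 1 - M) := pow_mul _ _ _
      _ ≤ K ^ (K + 1 - M) := Nat.pow_le_pow_left h2 _
  have h7 : 4 ≤ 4 ^ K := Nat.le_self_pow (by omega) 4
  calc 4 * (N ^ K * (M + 1 + K * N).choose M)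
      ≤ 4 ^ K * ((N + 1) ^ K * (K * (N + 1)) ^ M) :=
        Nat.mul_le_mul h7 (Nat.mul_le_mul h4 h3)
    _ = 4 ^ K * (N + 1) ^ K * K ^ M * (N + 1) ^ M := by rw [mul_pow]; ring
    _ ≤ 4 ^ K * (N + 1) ^ K * K ^ M * (N + 1) ^ K := Nat.mul_le_mul_left _ h5
    _ = K ^ M * (4 * (N + 1) ^ 2) ^ K := by rw [mul_pow, ← pow_mul]; ring
    _ ≤ K ^ M * K ^ (K + 1 - M) := Nat.mul_le_mul_left _ h6
    _ = K ^ (K + 1) := by rw [← pow_add]; congr 1; omega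

/-- The number of constraints is at most `K ^ (K + 2)`. -/
theorem num_constraints_le {K M X : ℕ} (hM : 0 < M) (hMX : M ≤ X) (hX : 4 * X ≤ K ^ (K + 1)) :
    K * X + K * K + (K + K * M) ≤ K ^ (K + 2) := by
  rcases Nat.lt_or_ge K 2 with hK | hK
  -- For `K ≤ 1`, `hX` forces `X = 0`, contradicting `0 < M ≤ X`.
  · interval_cases K <;> simp at hX <;> omega
  · have h1 : K ^ 4 ≤ K ^ (K + 2) := Nat.pow_le_pow_right (by omega) (by omega)
    have h2 : K * (4 * X) ≤ K ^ (K + 2) := by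
      rw [pow_succ' K (K + 1)]
      exact Nat.mul_le_mul_left K hX
    have h3 : K * M ≤ K * X := Nat.mul_le_mul_left K hMX
    have h4 : 2 * (K * K + K) ≤ K ^ 4 := by
      have : 4 ≤ K * K := Nat.mul_le_mul hK hK
      have h5 : K * K * 4 ≤ K ^ 4 := by
        rw [show K ^ 4 = K * K * (K * K) by ring]
        exact Nat.mul_le_mul_left _ this
      nlinarith
    nlinarith

theorem mainTheorem3 :
    (∀ (K M N : ℕ) [NeZero M] [NeZero N] (G : SigBSG K M N) (ε δ : ℝ),
      0 < ε → 0 < δ → (∀ k, δ * ‖G.valueVector k‖ ≤ ε) →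
      (∃ sel, G.IsVertexSelection δ sel) ∧
      ∀ sel, G.IsVertexSelection δ sel →
        (G.candidates sel).Finite ∧
        (∃ π ∈ G.candidates sel, G.IsEpsEquilibrium ε π) ∧
        (∀ π ∈ G.candidates sel,
          (∀ π' ∈ G.candidates sel, G.leaderUtility π' ≤ G.leaderUtility π) →
          G.IsEpsEquilibrium ε π)) ∧
    (∃ C c : ℝ, 0 < C ∧ 0 < c ∧
      (∀ (K M N : ℕ) [NeZero M] [NeZero N] (G : SigBSG K M N) (δ : ℝ)
        (sel : (Fin K → Fin K) → G.Signaling → G.Signaling),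
        0 < δ → G.IsVertexSelection δ sel →
        (G.vertexBeliefs.ncard : ℝ) ≤ c * (K : ℝ) ^ (K + 1) →
        ((G.candidates sel).ncard : ℝ) ≤
          C * (((K ^ (K + 2)).choose (K * G.vertexBeliefs.ncard) : ℕ) : ℝ) * (K : ℝ) ^ K) ∧
      (∀ (M N : ℕ) [NeZero M] [NeZero N], ∃ K₀ : ℕ, ∀ K ≥ K₀, ∀ G : SigBSG K M N,
        (G.vertexBeliefs.ncard : ℝ) ≤ c * (K : ℝ) ^ (K + 1))) := by
  -- With `c = 1 / 4`, the terms `K * X + K * M ≤ 2 * (K * X)` fill at most half of `K ^ (K + 2)`,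
  -- leaving half for `K * K + K`.
  refine ⟨?_, 1, 1 / 4, one_pos, by norm_num, ?_, ?_⟩
  · intro K M N _ _ G ε δ hε hδ hV
    have := G.neZero_types
    refine ⟨G.exists_isVertexSelection hδ, fun sel h => ?_⟩
    obtain ⟨γ, v, -, hs⟩ := G.exists_isLUB_vertex
    obtain ⟨π, hπ, hlt⟩ := G.exists_candidate_near hε hδ hV h hs
    refine ⟨(G.finite_candidates sel).1,
      ⟨π, hπ, G.candidates_subset_consistent h hπ, _, hs, hlt⟩, fun π' hπ' hmax => ?_⟩
    have := hmax π hπ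
    exact ⟨G.candidates_subset_consistent h hπ', _, hs, by linarith⟩
  · intro K M N _ _ G δ sel _ _ hX
    have := G.neZero_types
    have hX' : 4 * G.vertexBeliefs.ncard ≤ K ^ (K + 1) := by
      have : 4 * (G.vertexBeliefs.ncard : ℝ) ≤ (K : ℝ) ^ (K + 1) := by linarith
      exact_mod_cast this
    have hle := (G.finite_candidates sel).2.trans (Nat.mul_le_mul_left _
      (Nat.choose_le_choose (K * G.vertexBeliefs.ncard)
        (num_constraints_le (Nat.pos_of_ne_zero (NeZero.ne M))
          G.actions_le_ncard_vertexBeliefs hX')))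
    rw [mul_comm] at hle
    rw [one_mul]
    exact_mod_cast hle
  · intro M N _ _
    refine ⟨max (2 * (M + 1)) ((4 * (N + 1) ^ 2) ^ 2), fun K hK G => ?_⟩
    have h1 := four_mul_pow_mul_choose_le M N K ((le_max_left _ _).trans hK)
      ((le_max_right _ _).trans hK)
    have h2 : 4 * G.vertexBeliefs.ncard ≤ K ^ (K + 1) :=
      (Nat.mul_le_mul_left 4 G.ncard_vertexBeliefs_le).trans h1
    have h3 : 4 * (G.vertexBeliefs.ncard : ℝ) ≤ (K : ℝ) ^ (K + 1) := by exact_mod_cast h2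
    linarith
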